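/- Let $n\ge 2$, $j\ge 1$, $j\not\equiv 0\pmod n$. All functions are smooth, $S^1=\mathbb R/2\pi\mathbb Z$, $e_{ik}$ are the matrix units, $b=\sum_{i=1}^{n-1}e_{i+1,i}$, $J=e_{1n}\lambda+b$, $V_n=\bigoplus_{i=1}^{n-1}\mathbb R e_{in}$, $e_1=(1,0,\dots,0)^t$. For $A,C$ matrix valued, $[\partial_x+A,C]=C_x+AC-CA$. $\mathcal M_n(\mathbb R)$ (resp. $\mathcal M_n(S^1)$) is the set of smooth (resp. smooth $2\pi$-periodic) curves $\gamma:\mathbb R\to\mathbb R^n\setminus\{0\}$ with $\det(\gamma,\gamma_x,\dots,\gamma_x^{(n-1)})=1$. The central affine moving frame of $\gamma$ is $(\gamma,\gamma_x,\dots,\gamma_x^{(n-1)})$. Its $i$-th central affine curvature $u_i$ ($1\le i\le n-1$) is the determinant of the moving frame with its $i$-th column replaced by $\gamma_x^{(n)}$ (so $\gamma_x^{(n)}=u_1\gamma+\dots+u_{n-1}\gamma_x^{(n-2)}$), and we write $u=\sum_{i=1}^{n-1}u_ie_{in}$. For $u\in C^\infty(\mathbb R,V_n)$ let $Y(u,\lambda)=e_{1n}\lambda+\sum_{k\le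 0}Y_k\lambda^k$, $Y_k\in C^\infty(\mathbb R,sl(n,\mathbb R))$, be the unique formal series of this form with $[\partial_x+J+u,Y(u,\lambda)]=0$ and $Y(u,\lambda)^n=\lambda I_n$. Let $Y_{j,0}(u)$ be the coefficient of $\lambda^0$ in $Y(u,\lambda)^j$, let $\zeta_j(u)$ be the unique strictly upper triangular matrix function with $[\partial_x+b+u,\,Y_{j,0}(u)-\zeta_j(u)]\in V_n$, and put $Z_{j,0}(u)=Y_{j,0}(u)-\zeta_j(u)$. The $j$-th $A^{(1)}_{n-1}$-KdV flow is $u_t=[\partial_x+b+u,Z_{j,0}(u)]$ for $u(x,t)\in V_n$. The $j$-th central affine curve flow is $\gamma_t=gZ_{j,0}(u)e_1$ for $\gamma(\cdot,t)\in\mathcal M_n(\mathbb R)$, where $g(\cdot,t)$ and $u(\cdot,t)$ are the moving frame and the curvature of $\gamma(\cdot,t)$. **Theorem (Cauchy problem with periodic initial data).** Let $\gamma_0\in\mathcal M_n(S^1)$ have central affine curvatures $u_1^0,\dots,u_{n-1}^0$ and central affine moving frame $g_0$. Suppose $u=\sum_{i=1}^{n-1}u_ie_{in}\in C^\infty(\mathbb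 R^2,V_n)$ is a solution of the $j$-th $A^{(1)}_{n-1}$-KdV flow, $2\pi$-periodic in $x$, with $u(x,0)=\sum_{i=1}^{n-1}u_i^0(x)e_{in}$. Let $g:\mathbb R^2\to SL(n,\mathbb R)$ be a smooth solution of $$g^{-1}g_x=b+u,\qquad g^{-1}g_t=Z_{j,0}(u),\qquad g(0,0)=g_0(0).$$ Then $\gamma=ge_1$ is a solution of the $j$-th central affine curve flow with $\gamma(x,0)=\gamma_0(x)$ for all $x$. Moreover $\gamma(x,t)$ is $2\pi$-periodic in $x$, and $u_1(\cdot,t),\dots,u_{n-1}(\cdot,t)$ are the central affine curvatures of $\gamma(\cdot,t)$ for every $t$. -/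

import Mathlib

open scoped ContDiff

noncomputable section

namespace CentralAffine

variable {n : ℕ}

/-- Real `n × n` matrices. -/
abbrev Mat (n : ℕ) : Type := Matrix (Fin n) (Fin n) ℝ

/-! ### Matrix-valued functions: entrywise smoothness and derivative -/

/-- A matrix-valued function of one real variable is smooth. -/
def SmoothMat (A : ℝ → Mat n) : Prop :=
  ∀ i k, ContDiff ℝ ∞ (fun x => A x i k)

/-- A matrix-valued function of two real variables `(x, t)` is (jointly) smooth. -/
def SmoothMat₂ (A : ℝ → ℝ → Mat n) : Prop :=
  ∀ i k, ContDiff ℝ ∞ (fun p : ℝ × ℝ => A p.1 p.2 i k)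

/-- The entrywise derivative `A_x`. -/
def derivMat (A : ℝ → Mat n) (x : ℝ) : Mat n :=
  Matrix.of fun i k => deriv (fun y => A y i k) x

/-- The bracket `[∂ₓ + A, C] = C_x + A C - C A`. -/
def dBracket (A C : ℝ → Mat n) (x : ℝ) : Mat n :=
  derivMat C x + (A x * C x - C x * A x)

/-! ### The constant matrices and the space `V_n` -/

/-- The matrix unit `e_{1n}`. -/
def e1n (n : ℕ) : Mat n :=
  Matrix.of fun i k => if i.val = 0 ∧ k.val + 1 = n then 1 else 0

/-- `b = ∑_{i=1}^{n-1} e_{i+1,i}`. -/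
def bMat (n : ℕ) : Mat n :=
  Matrix.of fun i k => if i.val = k.val + 1 then 1 else 0

/-- The first standard basis vector `e_1`. -/
def e1 (n : ℕ) : Fin n → ℝ := fun i => if i.val = 0 then 1 else 0

/-- `V_n = ⊕_{i=1}^{n-1} ℝ e_{in}`. -/
def V (n : ℕ) : Set (Mat n) :=
  {A | ∀ i k : Fin n, ¬ (k.val + 1 = n ∧ i.val + 1 < n) → A i k = 0}

/-! ### Central affine curves -/

/-- The central affine moving frame `(γ, γ_x, …, γ_x^{(n-1)})`: column `k` (counted from `0`) is
`γ_x^{(k)}`. -/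
def frame (γ : ℝ → Fin n → ℝ) (x : ℝ) : Mat n :=
  Matrix.of fun i k => iteratedDeriv k.val γ x i

/-- `γ ∈ M_n(ℝ)`: a smooth curve in `ℝⁿ ∖ {0}` with `det(γ, γ_x, …, γ_x^{(n-1)}) = 1`. -/
structure IsCentralAffineCurve (γ : ℝ → Fin n → ℝ) : Prop where
  smooth : ContDiff ℝ ∞ γ
  ne_zero : ∀ x, γ x ≠ 0
  det_frame : ∀ x, (frame γ x).det = 1

/-- `γ ∈ M_n(S¹)`, with `S¹ = ℝ / 2πℤ`. -/
structure IsPeriodicCentralAffineCurve (γ : ℝ → Fin n → ℝ) : Prop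
    extends IsCentralAffineCurve γ where
  periodic : Function.Periodic γ (2 * Real.pi)

/-- The central affine curvature `u = ∑_{i=1}^{n-1} u_i e_{in}`, where `u_i` is the determinant of
the moving frame with its `i`-th column replaced by `γ_x^{(n)}`. -/
def curvature (γ : ℝ → Fin n → ℝ) (x : ℝ) : Mat n :=
  Matrix.of fun i k =>
    if k.val + 1 = n ∧ i.val + 1 < n then
      ((frame γ x).updateCol i (iteratedDeriv n γ x)).det
    else 0

/-! ### The `A^{(1)}_{n-1}`-KdV hierarchy

A formal series `∑_{k ≤ n₀} ξ_k λ^k` with matrix coefficients is a Laurent series in `λ⁻¹`. -/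

/-- Formal series `∑_{k ≤ n₀} ξ_k λ^k` with matrix coefficients. -/
abbrev Loop (n : ℕ) : Type := LaurentSeries (Mat n)

/-- The coefficient of `λ^k`. -/
def lcoeff (ξ : Loop n) (k : ℤ) : Mat n := HahnSeries.coeff ξ (-k)

/-- The monomial `A λ^k`. -/
def lmonomial (k : ℤ) (A : Mat n) : Loop n := HahnSeries.single (-k) A

/-- `J = e_{1n} λ + b`. -/
def J (n : ℕ) : Loop n := lmonomial 1 (e1n n) + lmonomial 0 (bMat n)

/-- `Y = Y(u, λ)`: the `sl(n, ℝ)`-valued formal series with `[∂ₓ + J + u, Y] = 0` and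
`Y^n = λ I`, normalized by `Y = e_{1n} λ + (terms of degree at most 0 in λ)`. -/
structure IsResolvent (u : ℝ → Mat n) (Y : ℝ → Loop n) : Prop where
  smooth : ∀ k, SmoothMat (fun x => lcoeff (Y x) k)
  trace_zero : ∀ x k, (lcoeff (Y x) k).trace = 0
  comm : ∀ x k, derivMat (fun y => lcoeff (Y y) k) x
    + lcoeff ((J n + lmonomial 0 (u x)) * Y x - Y x * (J n + lmonomial 0 (u x))) k = 0
  pow : ∀ x, Y x ^ n = lmonomial 1 1
  coeff_one : ∀ x, lcoeff (Y x) 1 = e1n n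
  coeff_gt : ∀ x k, 1 < k → lcoeff (Y x) k = 0

open Classical in
/-- The series `Y(u, λ)`. -/
def resolvent (u : ℝ → Mat n) : ℝ → Loop n :=
  if h : ∃ Y, IsResolvent u Y then h.choose else 0

/-- `Y_{j,0}(u)`: the coefficient of `λ^0` in `Y(u, λ)^j`. -/
def Yj0 (j : ℕ) (u : ℝ → Mat n) (x : ℝ) : Mat n := lcoeff (resolvent u x ^ j) 0

/-- `ζ = ζ_j(u)`: strictly upper triangular, with `[∂ₓ + b + u, Y_{j,0}(u) - ζ] ∈ V_n`. -/
structure IsZeta (j : ℕ) (u ζ : ℝ → Mat n) : Prop where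
  smooth : SmoothMat ζ
  strictUpper : ∀ x (i k : Fin n), k ≤ i → ζ x i k = 0
  mem_V : ∀ x, dBracket (fun y => bMat n + u y) (fun y => Yj0 j u y - ζ y) x ∈ V n

open Classical in
/-- The correction term `ζ_j(u)`. -/
def zeta (j : ℕ) (u : ℝ → Mat n) : ℝ → Mat n :=
  if h : ∃ ζ, IsZeta j u ζ then h.choose else 0

/-- `Z_{j,0}(u) = Y_{j,0}(u) - ζ_j(u)`. -/
def Zj0 (j : ℕ) (u : ℝ → Mat n) (x : ℝ) : Mat n := Yj0 j u x - zeta j u x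

/-- `u ∈ C^∞(ℝ², V_n)` solves the `j`-th `A^{(1)}_{n-1}`-KdV flow
`u_t = [∂ₓ + b + u, Z_{j,0}(u)]`; arguments are in the order `x`, `t`. -/
structure IsKdVSolution (j : ℕ) (u : ℝ → ℝ → Mat n) : Prop where
  smooth : SmoothMat₂ u
  mem_V : ∀ x t, u x t ∈ V n
  eqn : ∀ x t, derivMat (fun s => u x s) t
    = dBracket (fun y => bMat n + u y t) (Zj0 j (fun y => u y t)) x

/-- A solution of the `j`-th flow that is `2π`-periodic in `x`. -/
structure IsPeriodicKdVSolution (j : ℕ) (u : ℝ → ℝ → Mat n) : Prop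
    extends IsKdVSolution j u where
  periodic : ∀ t, Function.Periodic (fun x => u x t) (2 * Real.pi)

/-- `γ(x, t)` solves the `j`-th central affine curve flow `γ_t = g Z_{j,0}(u) e_1` on `M_n(ℝ)`,
where `g(·, t)` and `u(·, t)` are the moving frame and the curvature of `γ(·, t)`. -/
structure IsCurveFlowSolution (j : ℕ) (γ : ℝ → ℝ → Fin n → ℝ) : Prop where
  smooth : ContDiff ℝ ∞ (fun p : ℝ × ℝ => γ p.1 p.2)
  curve : ∀ t, IsCentralAffineCurve (fun x => γ x t)
  eqn : ∀ x t, deriv (fun s => γ x s) t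
    = (frame (fun y => γ y t) x * Zj0 j (curvature fun y => γ y t) x).mulVec (e1 n)

/-- `g : ℝ² → SL(n, ℝ)` is a smooth solution of `g⁻¹ g_x = b + u`, `g⁻¹ g_t = Z_{j,0}(u)`. -/
structure IsFrameSolution (j : ℕ) (u : ℝ → ℝ → Mat n)
    (g : ℝ → ℝ → Matrix.SpecialLinearGroup (Fin n) ℝ) : Prop where
  smooth : SmoothMat₂ (fun x t => (g x t : Mat n))
  eqn_x : ∀ x t, (g x t : Mat n)⁻¹ * derivMat (fun y => (g y t : Mat n)) x = bMat n + u x t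
  eqn_t : ∀ x t, (g x t : Mat n)⁻¹ * derivMat (fun s => (g x s : Mat n)) t
    = Zj0 j (fun y => u y t) x

end CentralAffine

end

/-!
The equation `g_x = g (b + u)` says that each column of `g` is the `x`-derivative of the preceding
one. Hence `g` is the central affine moving frame of its first column `γ = g e_1`, and Cramer's rule
applied to the last column identifies `u` with the curvature of `γ`
(`frame_eq_of_hasDerivMat`, `curvature_eq_of_hasDerivMat`). The flow equation for `γ` is then the
first column of `g_t = g Z_{j,0}(u)`.

The remaining claims rest on uniqueness for linear equations `F' = F A` (`eq_of_hasDerivMat_mul`).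
At `t = 0`, both `g` and the moving frame of `γ₀` solve `F_x = F (b + u)`; for the latter, the last
coordinate of `γ₀^{(n)}` in the moving frame vanishes because the moving frame has constant
determinant (`IsCentralAffineCurve.hasDerivMat_frame`). So they agree. In particular `g(·, 0)` is
`2π`-periodic, and `g(x + 2π, ·)` and `g(x, ·)` solve the same equation `F_t = F Z_{j,0}(u)(x, ·)`
with the same initial value, provided that `Z_{j,0}(u)` is `2π`-periodic in `x`.

The periodicity of `Z_{j,0}(u)` is the substantial point (`Zj0_periodic`): `Y(u, λ)` and `ζ_j(u)`
are characterized by conditions invariant under the translation `x ↦ x + 2π`, so it suffices that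
these conditions determine them.

For `Y(u, λ)` (`IsResolvent.unique`), use the principal grading, in which `λ^k e_{il}` has degree
`n k + i - l`, so that `J` is homogeneous of degree `1` and `u` has negative degree. The equation
`[∂ₓ + J + u, Y] = 0` shows that the top degree part of `Y - J` commutes with `J`. As `Y - J` has no
positive powers of `λ`, that part vanishes while its degree is positive, so `Y = J + (degree ≤ 0)`.
Let `D` be the top degree part of the difference of two such series `Y`, `Y'`. It commutes
with `J` too, so that the top degree part of `Y^n - Y'^n = 0` is `n D J^{n-1}`. Since `J` is
invertible, `D = 0`.

For `ζ_j(u)` (`IsZeta.unique`), one determines the diagonals one after the other, starting from the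
main diagonal, where it vanishes.
-/

open scoped ContDiff

namespace CentralAffine

/-! ### Multiplication by the constant matrices -/

section Entries

variable {n : ℕ}

lemma bMat_mul_apply_zero (A : Mat n) {i : Fin n} (k : Fin n) (hi : i.val = 0) :
    (bMat n * A) i k = 0 := by
  rw [Matrix.mul_apply]
  refine Finset.sum_eq_zero fun s _ => ?_
  simp [bMat, hi]

lemma bMat_mul_apply_succ (A : Mat n) {i i' : Fin n} (k : Fin n) (hi : i.val = i'.val + 1) :
    (bMat n * A) i k = A i' k := by
  rw [Matrix.mul_apply, Finset.sum_eq_single i']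
  · simp [bMat, hi]
  · intro s _ hs
    have : ¬ i.val = s.val + 1 := fun h => hs (Fin.ext (by omega))
    simp [bMat, this]
  · simp

lemma mul_bMat_apply_succ (A : Mat n) (i : Fin n) {k k' : Fin n} (hk : k'.val = k.val + 1) :
    (A * bMat n) i k = A i k' := by
  rw [Matrix.mul_apply, Finset.sum_eq_single k']
  · simp [bMat, hk]
  · intro s _ hs
    have : ¬ s.val = k.val + 1 := fun h => hs (Fin.ext (by omega))
    simp [bMat, this]
  · simp

lemma mul_bMat_apply_last (A : Mat n) (i : Fin n) {k : Fin n} (hk : k.val + 1 = n) :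
    (A * bMat n) i k = 0 := by
  rw [Matrix.mul_apply]
  refine Finset.sum_eq_zero fun s _ => ?_
  have : ¬ s.val = k.val + 1 := by have := s.isLt; omega
  simp [bMat, this]

lemma e1n_mul_apply_of_ne (A : Mat n) {i : Fin n} (k : Fin n) (hi : i.val ≠ 0) :
    (e1n n * A) i k = 0 := by
  rw [Matrix.mul_apply]
  refine Finset.sum_eq_zero fun s _ => ?_
  simp [e1n, hi]

lemma mul_e1n_apply_of_ne (A : Mat n) (i : Fin n) {k : Fin n} (hk : k.val + 1 ≠ n) :
    (A * e1n n) i k = 0 := by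
  rw [Matrix.mul_apply]
  refine Finset.sum_eq_zero fun s _ => ?_
  simp [e1n, hk]

lemma mul_e1n_apply_last (A : Mat n) (i : Fin n) {k z : Fin n} (hk : k.val + 1 = n)
    (hz : z.val = 0) : (A * e1n n) i k = A i z := by
  rw [Matrix.mul_apply, Finset.sum_eq_single z]
  · simp [e1n, hk, hz]
  · intro s _ hs
    have : ¬ s.val = 0 := fun h => hs (Fin.ext (by omega))
    simp [e1n, this]
  · simp

lemma mul_apply_of_mem_V {v : Mat n} (hv : v ∈ V n) (A : Mat n) (i : Fin n) {k : Fin n}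
    (hk : k.val + 1 ≠ n) : (A * v) i k = 0 := by
  rw [Matrix.mul_apply]
  refine Finset.sum_eq_zero fun s _ => ?_
  rw [hv s k (by omega), mul_zero]

lemma mem_V_mul_apply {v : Mat n} (hv : v ∈ V n) {A : Mat n} (i k : Fin n)
    (hA : ∀ s : Fin n, s.val + 1 = n → A s k = 0) : (v * A) i k = 0 := by
  rw [Matrix.mul_apply]
  refine Finset.sum_eq_zero fun s _ => ?_
  by_cases hs : s.val + 1 = n
  · rw [hA s hs, mul_zero]
  · rw [hv i s (by omega), zero_mul]

end Entries

/-! ### Coefficients and the principal grading of formal series -/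

section Grading

variable {n : ℕ}

@[simp] lemma lcoeff_zero (k : ℤ) : lcoeff (0 : Loop n) k = 0 := rfl

@[simp] lemma lcoeff_add (ξ η : Loop n) (k : ℤ) :
    lcoeff (ξ + η) k = lcoeff ξ k + lcoeff η k := rfl

@[simp] lemma lcoeff_sub (ξ η : Loop n) (k : ℤ) :
    lcoeff (ξ - η) k = lcoeff ξ k - lcoeff η k := by
  simp [lcoeff, HahnSeries.coeff_sub]

@[simp] lemma lcoeff_nsmul (m : ℕ) (ξ : Loop n) (k : ℤ) :
    lcoeff (m • ξ) k = m • lcoeff ξ k := by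
  simp [lcoeff, -nsmul_eq_mul]

lemma lcoeff_lmonomial (a : ℤ) (A : Mat n) (k : ℤ) :
    lcoeff (lmonomial a A) k = if k = a then A else 0 := by
  simp [lcoeff, lmonomial, HahnSeries.coeff_single]

lemma lcoeff_lmonomial_mul (a : ℤ) (A : Mat n) (ξ : Loop n) (k : ℤ) :
    lcoeff (lmonomial a A * ξ) k = A * lcoeff ξ (k - a) := by
  have := HahnSeries.coeff_single_mul_add (r := A) (x := ξ) (a := -(k - a)) (b := -a)
  rw [show -(k - a) + -a = -k by ring] at this
  exact this

lemma lcoeff_mul_lmonomial (a : ℤ) (A : Mat n) (ξ : Loop n) (k : ℤ) :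
    lcoeff (ξ * lmonomial a A) k = lcoeff ξ (k - a) * A := by
  have := HahnSeries.coeff_mul_single_add (r := A) (x := ξ) (a := -(k - a)) (b := -a)
  rw [show -(k - a) + -a = -k by ring] at this
  exact this

lemma loop_ext {ξ η : Loop n} (h : ∀ k, lcoeff ξ k = lcoeff η k) : ξ = η := by
  ext1
  funext k
  simpa [lcoeff] using h (-k)

/-- `ξ` has principal degree at most `d`, where `λ^k e_{il}` has principal degree
`n k + i - l`. In this grading `J` is homogeneous of degree `1`. -/
def DegLE (d : ℤ) (ξ : Loop n) : Prop :=
  ∀ (k : ℤ) (i l : Fin n), d < n * k + i.val - l.val → lcoeff ξ k i l = 0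

lemma DegLE.mono {d e : ℤ} {ξ : Loop n} (h : DegLE d ξ) (hde : d ≤ e) : DegLE e ξ :=
  fun k i l hk => h k i l (by omega)

lemma DegLE.add {d : ℤ} {ξ η : Loop n} (hξ : DegLE d ξ) (hη : DegLE d η) :
    DegLE d (ξ + η) := fun k i l hk => by
  simp [hξ k i l hk, hη k i l hk]

lemma DegLE.sub {d : ℤ} {ξ η : Loop n} (hξ : DegLE d ξ) (hη : DegLE d η) :
    DegLE d (ξ - η) := fun k i l hk => by
  simp [hξ k i l hk, hη k i l hk]

lemma degLE_zero (d : ℤ) : DegLE d (0 : Loop n) := fun _ _ _ _ => rfl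

lemma DegLE.mul {d e : ℤ} {ξ η : Loop n} (hξ : DegLE d ξ) (hη : DegLE e η) :
    DegLE (d + e) (ξ * η) := by
  intro k i l hk
  rw [lcoeff, HahnSeries.coeff_mul, Matrix.sum_apply]
  refine Finset.sum_eq_zero fun ij hij => ?_
  have hsum : ij.1 + ij.2 = -k := (Finset.mem_antidiagonal.mp hij).2.2
  rw [Matrix.mul_apply]
  refine Finset.sum_eq_zero fun s _ => ?_
  have hk' : (n : ℤ) * k = n * (-ij.1) + n * (-ij.2) := by
    rw [← mul_add]; congr 1; omega
  rcases lt_or_ge d (n * (-ij.1) + i.val - s.val) with h | h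
  · have := hξ (-ij.1) i s h
    rw [lcoeff, neg_neg] at this
    rw [this, zero_mul]
  · have := hη (-ij.2) s l (by omega)
    rw [lcoeff, neg_neg] at this
    rw [this, mul_zero]

lemma degLE_J : DegLE 1 (J n) := by
  intro k i l hk
  simp only [J, lcoeff_add, lcoeff_lmonomial, Matrix.add_apply]
  have h1 : (if k = 1 then e1n n else 0) i l = 0 := by
    split_ifs with h
    · subst h
      have : ¬ (i.val = 0 ∧ l.val + 1 = n) := by omega
      simp [e1n, this]
    · rfl
  have h2 : (if k = 0 then bMat n else 0) i l = 0 := by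
    split_ifs with h
    · subst h
      have : ¬ (i.val = l.val + 1) := by omega
      simp [bMat, this]
    · rfl
  rw [h1, h2, add_zero]

lemma degLE_of_mem_V {v : Mat n} (hv : v ∈ V n) : DegLE (-1) (lmonomial 0 v) := by
  intro k i l hk
  rw [lcoeff_lmonomial]
  split_ifs with h
  · subst h
    exact hv i l (by omega)
  · rfl

lemma lcoeff_J_commutator (ξ : Loop n) (k : ℤ) :
    lcoeff (J n * ξ - ξ * J n) k = (e1n n * lcoeff ξ (k - 1) + bMat n * lcoeff ξ k)
      - (lcoeff ξ (k - 1) * e1n n + lcoeff ξ k * bMat n) := by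
  simp [J, add_mul, mul_add, lcoeff_lmonomial_mul, lcoeff_mul_lmonomial]

/-- The part of degree `d ≥ 1` of a series commuting with `J` up to degree `d` is constant along
the orbit of conjugation by `J`; that orbit meets the coefficient of `λ`, so the part vanishes
as soon as the coefficients of positive powers of `λ` do. -/
lemma DegLE.descend_of_J_commutator {d : ℤ} (hd : 1 ≤ d) {ξ : Loop n}
    (hpos : ∀ k, 1 ≤ k → lcoeff ξ k = 0) (hξ : DegLE d ξ)
    (hJ : DegLE d (J n * ξ - ξ * J n)) : DegLE (d - 1) ξ := by
  have key : ∀ (m : ℕ) (i l : Fin n), l.val = m → (i.val : ℤ) = m + d → lcoeff ξ 0 i l = 0 := by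
    intro m
    induction m with
    | zero =>
      intro i l hl hi
      have hn : 0 < n := i.pos
      have h := hJ 1 i ⟨n - 1, by omega⟩ (by push_cast [Nat.cast_sub hn]; omega)
      rw [lcoeff_J_commutator, hpos 1 le_rfl] at h
      simpa [e1n_mul_apply_of_ne _ _ (show i.val ≠ 0 by omega),
        mul_e1n_apply_last _ _ (k := ⟨n - 1, by omega⟩) (show n - 1 + 1 = n by omega) hl] using h
    | succ m ih =>
      intro i l hl hi
      have hi' := i.isLt
      have hl' := l.isLt
      have h := hJ 0 i ⟨m, by omega⟩ (by simp only; omega)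
      rw [lcoeff_J_commutator] at h
      simpa [e1n_mul_apply_of_ne _ _ (show i.val ≠ 0 by omega),
        mul_e1n_apply_of_ne _ _ (k := ⟨m, by omega⟩) (show m + 1 ≠ n by omega),
        mul_bMat_apply_succ _ _ (k := ⟨m, by omega⟩) hl,
        bMat_mul_apply_succ _ (i := i) (i' := ⟨i.val - 1, by omega⟩) _
          (show i.val = i.val - 1 + 1 by omega),
        ih ⟨i.val - 1, by omega⟩ ⟨m, by omega⟩ rfl (by simp only; omega)] using h
  intro k i l hk
  rcases lt_or_ge d (n * k + i.val - l.val) with h | h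
  · exact hξ k i l h
  rcases lt_or_ge 0 k with hk1 | hk0
  · rw [hpos k hk1]; rfl
  · have hk00 : k = 0 := by
      by_contra hne
      have : (n : ℤ) * k ≤ n * (-1) := mul_le_mul_of_nonneg_left (by omega) (by omega)
      have := i.isLt
      omega
    subst hk00
    exact key l.val i l rfl (by omega)

end Grading

/-! ### Uniqueness of the resolvent -/

section Resolvent

variable {n : ℕ}

/-- The coefficient of `λ^k` in `[∂ₓ + J + u, Y]`. -/
noncomputable def loopBracket (u : ℝ → Mat n) (Y : ℝ → Loop n) (x : ℝ) (k : ℤ) : Mat n :=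
  derivMat (fun y => lcoeff (Y y) k) x
    + lcoeff ((J n + lmonomial 0 (u x)) * Y x - Y x * (J n + lmonomial 0 (u x))) k

/-- Since `∂ₓ` preserves the principal degree and `u` has negative degree, the operator
`[∂ₓ + J + u, ·]` agrees with `[J, ·]` on the top degree part. -/
lemma degLE_J_commutator_sub {u : ℝ → Mat n} (hu : ∀ x, u x ∈ V n) {Y Y' : ℝ → Loop n} {d : ℤ}
    (hY : ∀ x k (i l : Fin n), d < n * k + i.val - l.val → loopBracket u Y x k i l = 0)
    (hY' : ∀ x k (i l : Fin n), d < n * k + i.val - l.val → loopBracket u Y' x k i l = 0)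
    (hD : ∀ x, DegLE d (Y x - Y' x)) (x : ℝ) :
    DegLE d (J n * (Y x - Y' x) - (Y x - Y' x) * J n) := by
  intro k i l hk
  have hfun : (fun y => lcoeff (Y y) k i l) = fun y => lcoeff (Y' y) k i l := by
    funext y
    simpa [sub_eq_zero] using hD y k i l hk
  have hderiv : derivMat (fun y => lcoeff (Y y) k) x i l
      = derivMat (fun y => lcoeff (Y' y) k) x i l := by
    simp only [derivMat, Matrix.of_apply, hfun]
  have h1 := hY x k i l hk
  have h2 := hY' x k i l hk
  have hu1 := ((degLE_of_mem_V (hu x)).mul (hD x)).mono (show -1 + d ≤ d by omega) k i l hk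
  have hu2 := ((hD x).mul (degLE_of_mem_V (hu x))).mono (show d + -1 ≤ d by omega) k i l hk
  simp only [loopBracket, mul_add, add_mul, mul_sub, sub_mul, lcoeff_sub, lcoeff_add,
    Matrix.add_apply, Matrix.sub_apply] at *
  linarith

lemma IsResolvent.loopBracket_eq_zero {u : ℝ → Mat n} {Y : ℝ → Loop n} (hY : IsResolvent u Y)
    (x : ℝ) (k : ℤ) : loopBracket u Y x k = 0 := hY.comm x k

lemma IsResolvent.lcoeff_sub_J {u : ℝ → Mat n} {Y : ℝ → Loop n} (hY : IsResolvent u Y) (x : ℝ)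
    {k : ℤ} (hk : 1 ≤ k) : lcoeff (Y x - J n) k = 0 := by
  rcases hk.eq_or_lt with rfl | hk
  · simp [J, lcoeff_lmonomial, hY.coeff_one]
  · simp [J, lcoeff_lmonomial, hY.coeff_gt x k hk, hk.ne', (zero_lt_one.trans hk).ne']

lemma loopBracket_J {u : ℝ → Mat n} (hu : ∀ x, u x ∈ V n) (x : ℝ) (k : ℤ) (i l : Fin n)
    (hk : 0 < (n : ℤ) * k + i.val - l.val) : loopBracket u (fun _ => J n) x k i l = 0 := by
  have h1 := (degLE_of_mem_V (hu x)).mul degLE_J k i l hk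
  have h2 := degLE_J.mul (degLE_of_mem_V (hu x)) k i l hk
  simp [loopBracket, derivMat, mul_add, add_mul, h1, h2]

section RingIdentities

variable {R : Type*} [Ring R]

lemma mul_sub_mul_eq_of_shift (ξ η ν a : R) :
    ξ * ν - ν * η = a * ν - ν * a + (ξ - a) * ν - ν * (η - a) := by
  noncomm_ring

lemma pow_succ_mul_sub_mul_pow_succ (ξ η ν : R) (k : ℕ) :
    ξ ^ (k + 1 + 1) * ν - ν * η ^ (k + 1 + 1)
      = ξ ^ (k + 1) * (ξ * ν - ν * η) + (ξ ^ (k + 1) * ν - ν * η ^ (k + 1)) * η := by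
  rw [pow_succ ξ (k + 1), pow_succ η (k + 1)]
  noncomm_ring

lemma pow_succ_sub_pow_succ_sub_nsmul (ξ η : R) (k : ℕ) :
    ξ ^ (k + 1 + 1) - η ^ (k + 1 + 1) - (k + 1 + 1) • ((ξ - η) * η ^ (k + 1))
      = (ξ ^ (k + 1) * (ξ - η) - (ξ - η) * η ^ (k + 1))
        + (ξ ^ (k + 1) - η ^ (k + 1) - (k + 1) • ((ξ - η) * η ^ k)) * η := by
  rw [succ_nsmul ((ξ - η) * η ^ (k + 1)), sub_mul (ξ ^ (k + 1) - η ^ (k + 1)) _ η,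
    smul_mul_assoc, mul_assoc (ξ - η), ← pow_succ η k, sub_mul (ξ ^ (k + 1)) _ η,
    ← pow_succ η (k + 1), pow_succ ξ (k + 1), mul_sub]
  abel

lemma sub_sub_nsmul_mul_of_pow_eq {ξ η : R} {m : ℕ} (h : ξ ^ (m + 1) = η ^ (m + 1)) :
    (ξ ^ (m + 1) - η ^ (m + 1) - (m + 1) • ((ξ - η) * η ^ m)) * η
      = 0 - (m + 1) • ((ξ - η) * η ^ (m + 1)) := by
  rw [h, sub_self, sub_mul, zero_mul, smul_mul_assoc, mul_assoc, ← pow_succ]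

end RingIdentities

/-- A resolvent is `J` plus terms of nonpositive principal degree. -/
lemma IsResolvent.degLE_sub_J {u : ℝ → Mat n} (hu : ∀ x, u x ∈ V n) {Y : ℝ → Loop n}
    (hY : IsResolvent u Y) (x : ℝ) : DegLE 0 (Y x - J n) := by
  have descend : ∀ m : ℕ, (∀ x, DegLE (m : ℤ) (Y x - J n)) → ∀ x, DegLE 0 (Y x - J n) := by
    intro m
    induction m with
    | zero => exact fun h => h
    | succ m ih =>
      intro h
      refine ih fun x => ?_
      have hJ := degLE_J_commutator_sub hu (Y' := fun _ => J n)
        (fun x k i l _ => by rw [hY.loopBracket_eq_zero]; rfl)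
        (fun x k i l hk => loopBracket_J hu x k i l (by omega)) h x
      have := DegLE.descend_of_J_commutator (by omega) (fun k => hY.lcoeff_sub_J x) (h x) hJ
      exact this.mono (by omega)
  refine descend n (fun x k i l hk => ?_) x
  rcases lt_or_ge 0 k with hk1 | hk0
  · rw [hY.lcoeff_sub_J x hk1]; rfl
  · have : (n : ℤ) * k ≤ 0 := mul_nonpos_of_nonneg_of_nonpos (by omega) hk0
    have := i.isLt
    omega

lemma degLE_of_sub_J {ξ : Loop n} (h : DegLE 0 (ξ - J n)) : DegLE 1 ξ := by
  have := (h.mono zero_le_one).add degLE_J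
  rwa [sub_add_cancel] at this

lemma degLE_pow {ξ : Loop n} (h : DegLE 1 ξ) (k : ℕ) : DegLE ((k : ℤ) + 1) (ξ ^ (k + 1)) := by
  induction k with
  | zero => simpa using h
  | succ k ih =>
    rw [pow_succ]
    exact (ih.mul h).mono (by push_cast; omega)

/-- Modulo lower order terms, two resolvents commute with their difference. -/
lemma degLE_pow_mul_sub {d : ℤ} {ξ η ν : Loop n} (hξ : DegLE 0 (ξ - J n))
    (hη : DegLE 0 (η - J n)) (hν : DegLE d ν) (hJ : DegLE d (J n * ν - ν * J n)) (k : ℕ) :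
    DegLE (d + k) (ξ ^ (k + 1) * ν - ν * η ^ (k + 1)) := by
  have base : DegLE d (ξ * ν - ν * η) := by
    have h := (hJ.add ((hξ.mul hν).mono (zero_add d).le)).sub ((hν.mul hη).mono (add_zero d).le)
    have e : ξ * ν - ν * η
        = J n * ν - ν * J n + (ξ - J n) * ν - ν * (η - J n) := mul_sub_mul_eq_of_shift ..
    rwa [e]
  induction k with
  | zero => simpa using base
  | succ k ih =>
    have h := (((degLE_pow (degLE_of_sub_J hξ) k).mul base).mono
      (show (k : ℤ) + 1 + d ≤ d + (k + 1 : ℕ) by push_cast; omega)).add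
      ((ih.mul (degLE_of_sub_J hη)).mono
        (show d + (k : ℤ) + 1 ≤ d + (k + 1 : ℕ) by push_cast; omega))
    have e : ξ ^ (k + 1 + 1) * ν - ν * η ^ (k + 1 + 1)
        = ξ ^ (k + 1) * (ξ * ν - ν * η) + (ξ ^ (k + 1) * ν - ν * η ^ (k + 1)) * η :=
      pow_succ_mul_sub_mul_pow_succ ..
    rwa [e]

/-- `ξ^{k+1} - η^{k+1} ≡ (k+1) (ξ - η) η^k` modulo lower order terms. -/
lemma degLE_pow_sub_pow {d : ℤ} {ξ η : Loop n} (hξ : DegLE 0 (ξ - J n))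
    (hη : DegLE 0 (η - J n)) (hD : DegLE d (ξ - η))
    (hJ : DegLE d (J n * (ξ - η) - (ξ - η) * J n)) (k : ℕ) :
    DegLE (d + k - 1) (ξ ^ (k + 1) - η ^ (k + 1) - (k + 1) • ((ξ - η) * η ^ k)) := by
  induction k with
  | zero => simpa using degLE_zero _
  | succ k ih =>
    have h := ((degLE_pow_mul_sub hξ hη hD hJ k).mono
      (show d + (k : ℤ) ≤ d + (k + 1 : ℕ) - 1 by push_cast; omega)).add
      ((ih.mul (degLE_of_sub_J hη)).mono
        (show d + (k : ℤ) - 1 + 1 ≤ d + (k + 1 : ℕ) - 1 by push_cast; omega))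
    have e : ξ ^ (k + 1 + 1) - η ^ (k + 1 + 1) - (k + 1 + 1) • ((ξ - η) * η ^ (k + 1))
        = (ξ ^ (k + 1) * (ξ - η) - (ξ - η) * η ^ (k + 1))
          + (ξ ^ (k + 1) - η ^ (k + 1) - (k + 1) • ((ξ - η) * η ^ k)) * η :=
      pow_succ_sub_pow_succ_sub_nsmul ..
    rwa [e]

/-- The resolvent of a `V_n`-valued function is unique: the top degree part `D` of the difference
of two resolvents satisfies `n D J^{n-1} = 0`, because both have `n`-th power `λ`. -/
theorem IsResolvent.unique (hn : 1 ≤ n) {u : ℝ → Mat n} (hu : ∀ x, u x ∈ V n)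
    {Y Y' : ℝ → Loop n} (hY : IsResolvent u Y) (hY' : IsResolvent u Y') : Y = Y' := by
  have descend : ∀ d : ℤ, (∀ x, DegLE d (Y x - Y' x)) → ∀ x, DegLE (d - 1) (Y x - Y' x) := by
    intro d hD x
    have hJ := degLE_J_commutator_sub hu
      (fun x k i l _ => by rw [hY.loopBracket_eq_zero]; rfl)
      (fun x k i l _ => by rw [hY'.loopBracket_eq_zero]; rfl) hD x
    have hη := hY'.degLE_sub_J hu x
    obtain ⟨m, rfl⟩ : ∃ m, n = m + 1 := ⟨n - 1, by omega⟩
    -- The `n`-th powers cancel; one more factor `Y'` turns `Y'^{n-1}` into the central `λ`.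
    have h := (degLE_pow_sub_pow (hY.degLE_sub_J hu x) hη (hD x) hJ m).mul (degLE_of_sub_J hη)
    rw [sub_sub_nsmul_mul_of_pow_eq ((hY.pow x).trans (hY'.pow x).symm), hY'.pow] at h
    intro k i l hk
    have h0 := h (k + 1) i l (by push_cast at hk ⊢; linarith)
    rw [lcoeff_sub, lcoeff_nsmul, lcoeff_mul_lmonomial, lcoeff_zero, mul_one,
      add_sub_cancel_right] at h0
    simpa [-nsmul_eq_mul, Nat.cast_add_one_ne_zero] using h0
  have hall : ∀ m : ℕ, ∀ x, DegLE (-(m : ℤ)) (Y x - Y' x) := by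
    intro m
    induction m with
    | zero =>
      intro x
      have := (hY.degLE_sub_J hu x).sub (hY'.degLE_sub_J hu x)
      simpa using this
    | succ m ih =>
      intro x
      exact (descend _ ih x).mono (by push_cast; omega)
  funext x
  refine loop_ext fun k => ?_
  ext i l
  have := hall (-(n * k + i.val - l.val) + 1).toNat x k i l (by omega)
  simpa [sub_eq_zero] using this

end Resolvent

/-! ### Uniqueness of the correction term, and translations -/

section Translation

variable {n : ℕ}

/-- The correction term is unique. Let `δ` be the difference of two correction terms. Outside the
last column `[∂ₓ + b + u, δ] = 0`, and on a diagonal where `δ` already vanishes this reduces to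
`[b, δ] = 0`, which determines the entries of `δ` on the next diagonal from the top down. -/
theorem IsZeta.unique {j : ℕ} {u : ℝ → Mat n} (hu : ∀ x, u x ∈ V n) {ζ ζ' : ℝ → Mat n}
    (hζ : IsZeta j u ζ) (hζ' : IsZeta j u ζ') : ζ = ζ' := by
  have step : ∀ (p q q' : Fin n), q.val = q'.val + 1 → (∀ y, ζ y p q' = ζ' y p q') → ∀ x,
      (bMat n * (ζ x - ζ' x)) p q' = 0 → ζ x p q = ζ' x p q := by
    intro p q q' hq hpq x hb
    have hq' : q'.val + 1 ≠ n := by have := q.isLt; omega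
    have h1 := hζ.mem_V x p q' (by omega)
    have h2 := hζ'.mem_V x p q' (by omega)
    have hderiv : derivMat (fun y => Yj0 j u y - ζ y) x p q'
        = derivMat (fun y => Yj0 j u y - ζ' y) x p q' := by
      simp only [derivMat, Matrix.of_apply, Matrix.sub_apply, hpq]
    have hu1 : (u x * (ζ x - ζ' x)) p q' = 0 := by
      refine mem_V_mul_apply (hu x) p q' fun s hs => ?_
      have hle : q' ≤ s := by rw [Fin.le_def]; have := q'.isLt; omega
      rw [Matrix.sub_apply, hζ.strictUpper x s q' hle, hζ'.strictUpper x s q' hle, sub_zero]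
    have hu2 := mul_apply_of_mem_V (hu x) (ζ x) p hq'
    have hu3 := mul_apply_of_mem_V (hu x) (ζ' x) p hq'
    have hb1 := mul_bMat_apply_succ (ζ x) p hq
    have hb2 := mul_bMat_apply_succ (ζ' x) p hq
    simp only [dBracket, add_mul, mul_add, mul_sub, sub_mul, Matrix.add_apply,
      Matrix.sub_apply] at h1 h2 hu1 hb
    linarith
  have key : ∀ r i : ℕ, ∀ (x : ℝ) (p q : Fin n), p.val = i → q.val = i + r →
      ζ x p q = ζ' x p q := by
    intro r
    induction r with
    | zero =>
      intro i x p q hp hq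
      rw [hζ.strictUpper x p q (by rw [Fin.le_def]; omega),
        hζ'.strictUpper x p q (by rw [Fin.le_def]; omega)]
    | succ r ihr =>
      intro i
      induction i with
      | zero =>
        intro x p q hp hq
        exact step p q ⟨r, by omega⟩ (by simp only; omega)
          (fun y => ihr 0 y p _ hp (by simp only; omega)) x (bMat_mul_apply_zero _ _ hp)
      | succ i ihi =>
        intro x p q hp hq
        refine step p q ⟨i + 1 + r, by omega⟩ (by simp only; omega)
          (fun y => ihr (i + 1) y p _ hp rfl) x ?_
        rw [bMat_mul_apply_succ _ (i' := ⟨i, by omega⟩) _ hp, Matrix.sub_apply,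
          ihi x _ _ rfl (by simp only; omega), sub_self]
  funext x
  ext p q
  rcases le_or_gt p q with h | h
  · exact key (q.val - p.val) p.val x p q rfl (by rw [Fin.le_def] at h; omega)
  · rw [hζ.strictUpper x p q h.le, hζ'.strictUpper x p q h.le]

lemma SmoothMat.comp_add_const {A : ℝ → Mat n} (hA : SmoothMat A) (a : ℝ) :
    SmoothMat (fun x => A (x + a)) :=
  fun i k => (hA i k).comp (contDiff_id.add contDiff_const)

lemma derivMat_comp_add_const (A : ℝ → Mat n) (a x : ℝ) :
    derivMat (fun y => A (y + a)) x = derivMat A (x + a) := by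
  ext i k
  exact deriv_comp_add_const (fun y => A y i k) a x

lemma IsResolvent.comp_add_const {u : ℝ → Mat n} {Y : ℝ → Loop n} (hY : IsResolvent u Y)
    (a : ℝ) : IsResolvent (fun x => u (x + a)) (fun x => Y (x + a)) where
  smooth k := (hY.smooth k).comp_add_const a
  trace_zero x := hY.trace_zero (x + a)
  comm x k := by
    rw [derivMat_comp_add_const (fun y => lcoeff (Y y) k)]
    exact hY.comm (x + a) k
  pow x := hY.pow (x + a)
  coeff_one x := hY.coeff_one (x + a)
  coeff_gt x := hY.coeff_gt (x + a)

lemma isResolvent_resolvent {u : ℝ → Mat n} (h : ∃ Y, IsResolvent u Y) :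
    IsResolvent u (resolvent u) := by
  rw [resolvent, dif_pos h]
  exact h.choose_spec

lemma isZeta_zeta {j : ℕ} {u : ℝ → Mat n} (h : ∃ ζ, IsZeta j u ζ) : IsZeta j u (zeta j u) := by
  rw [zeta, dif_pos h]
  exact h.choose_spec

/-- A periodic `V_n`-valued function has a periodic resolvent, by uniqueness. -/
lemma resolvent_periodic (hn : 1 ≤ n) {u : ℝ → Mat n} (hu : ∀ x, u x ∈ V n) {T : ℝ}
    (hT : Function.Periodic u T) : Function.Periodic (resolvent u) T := by
  by_cases h : ∃ Y, IsResolvent u Y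
  · have hY := isResolvent_resolvent h
    have hY' := hY.comp_add_const T
    rw [show (fun x => u (x + T)) = u from funext hT] at hY'
    exact congrFun (hY'.unique hn hu hY)
  · -- Only uniqueness matters here: the default value of `resolvent` is constant.
    rw [resolvent, dif_neg h]
    exact fun _ => rfl

lemma IsZeta.comp_add_period {j : ℕ} {u ζ : ℝ → Mat n} {T : ℝ} (hu : Function.Periodic u T)
    (hY : Function.Periodic (Yj0 j u) T) (hζ : IsZeta j u ζ) :
    IsZeta j u (fun x => ζ (x + T)) where
  smooth := hζ.smooth.comp_add_const T
  strictUpper x := hζ.strictUpper (x + T)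
  mem_V x := by
    have h := hζ.mem_V (x + T)
    rw [dBracket, ← derivMat_comp_add_const] at h
    simpa only [dBracket, hu _, hY _] using h

lemma Zj0_periodic (hn : 1 ≤ n) (j : ℕ) {u : ℝ → Mat n} (hu : ∀ x, u x ∈ V n) {T : ℝ}
    (hT : Function.Periodic u T) : Function.Periodic (Zj0 j u) T := by
  have hY : Function.Periodic (Yj0 j u) T := fun x => by
    rw [Yj0, Yj0, resolvent_periodic hn hu hT x]
  have hζ : Function.Periodic (zeta j u) T := by
    by_cases h : ∃ ζ, IsZeta j u ζ
    · have hz := isZeta_zeta h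
      exact congrFun ((hz.comp_add_period hT hY).unique hu hz)
    · rw [zeta, dif_neg h]
      exact fun _ => rfl
  intro x
  rw [Zj0, Zj0, hY x, hζ x]

end Translation

/-! ### Calculus of matrix-valued functions -/

section Calculus

variable {n : ℕ}

/-- Entrywise differentiability: `A` has derivative `A'` at `x`. -/
def HasDerivMat (A : ℝ → Mat n) (A' : Mat n) (x : ℝ) : Prop :=
  ∀ i k, HasDerivAt (fun y => A y i k) (A' i k) x

lemma SmoothMat.hasDerivMat {A : ℝ → Mat n} (hA : SmoothMat A) (x : ℝ) :
    HasDerivMat A (derivMat A x) x := fun i k =>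
  ((hA i k).differentiable (by simp) x).hasDerivAt

lemma HasDerivMat.mul {A B : ℝ → Mat n} {A' B' : Mat n} {x : ℝ} (hA : HasDerivMat A A' x)
    (hB : HasDerivMat B B' x) : HasDerivMat (fun y => A y * B y) (A' * B x + A x * B') x := by
  intro i k
  simp only [Matrix.mul_apply, Matrix.add_apply, ← Finset.sum_add_distrib]
  exact HasDerivAt.fun_sum fun s _ => (hA i s).mul (hB s k)

lemma HasDerivMat.unique {A : ℝ → Mat n} {A' A'' : Mat n} {x : ℝ} (h : HasDerivMat A A' x)
    (h' : HasDerivMat A A'' x) : A' = A'' := by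
  ext i k
  exact (h i k).unique (h' i k)

lemma hasDerivMat_const (A : Mat n) (x : ℝ) : HasDerivMat (fun _ => A) 0 x :=
  fun i k => hasDerivAt_const x (A i k)

lemma contDiff_det {A : ℝ → Mat n} (hA : SmoothMat A) : ContDiff ℝ ∞ (fun x => (A x).det) := by
  simp only [Matrix.det_apply']
  exact ContDiff.sum fun σ _ => contDiff_const.mul (contDiff_prod fun i _ => hA (σ i) i)

lemma SmoothMat.adjugate {A : ℝ → Mat n} (hA : SmoothMat A) :
    SmoothMat (fun x => (A x).adjugate) := by
  intro i k
  simp only [Matrix.adjugate_apply]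
  refine contDiff_det fun p q => ?_
  by_cases hp : p = k
  · subst hp
    simpa using contDiff_const
  · simpa [Matrix.updateRow_ne hp] using hA p q

/-- Jacobi's formula, column by column. -/
lemma HasDerivMat.det {A : ℝ → Mat n} {A' : Mat n} {x : ℝ} (hA : HasDerivMat A A' x) :
    HasDerivAt (fun y => (A y).det) (∑ k, ((A x).updateCol k fun i => A' i k).det) x := by
  have hsum : (∑ k, ((A x).updateCol k fun i => A' i k).det)
      = ∑ σ : Equiv.Perm (Fin n), ∑ k, ((Equiv.Perm.sign σ : ℤ) : ℝ)
        * ∏ i, (A x).updateCol k (fun i => A' i k) (σ i) i := by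
    simp only [Matrix.det_apply']
    exact Finset.sum_comm
  rw [hsum]
  simp only [Matrix.det_apply']
  refine HasDerivAt.fun_sum fun σ _ => ?_
  rw [← Finset.mul_sum]
  have h := HasDerivAt.fun_finsetProd (u := Finset.univ) (f := fun k y => A y (σ k) k)
    (f' := fun k => A' (σ k) k) fun k _ => hA (σ k) k
  refine (h.const_mul _).congr_deriv (congrArg _ ?_)
  refine Finset.sum_congr rfl fun k _ => ?_
  rw [← Finset.prod_erase_mul _ _ (Finset.mem_univ k), smul_eq_mul]
  congr 1
  · exact Finset.prod_congr rfl fun i hi => by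
      rw [Matrix.updateCol_ne (Finset.ne_of_mem_erase hi)]
  · rw [Matrix.updateCol_self]

/-- Two solutions of `F' = F A` that agree at one point agree: `F G⁻¹` is constant. -/
theorem eq_of_hasDerivMat_mul {F G A : ℝ → Mat n} (hF : ∀ x, HasDerivMat F (F x * A x) x)
    (hG : ∀ x, HasDerivMat G (G x * A x) x) (hGs : SmoothMat G) (hdet : ∀ x, (G x).det = 1)
    {a : ℝ} (ha : F a = G a) (x : ℝ) : F x = G x := by
  have hGa : ∀ y, G y * (G y).adjugate = 1 := fun y => by
    rw [Matrix.mul_adjugate, hdet, one_smul]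
  have haG : ∀ y, (G y).adjugate * G y = 1 := fun y => by
    rw [Matrix.adjugate_mul, hdet, one_smul]
  have hadj : ∀ y, HasDerivMat (fun y => (G y).adjugate) (-(A y * (G y).adjugate)) y := by
    intro y
    have h := hGs.adjugate.hasDerivMat y
    have hprod := (hG y).mul h
    simp only [hGa] at hprod
    have h0 := hprod.unique (hasDerivMat_const 1 y)
    have h1 := congrArg ((G y).adjugate * ·) (eq_neg_of_add_eq_zero_right h0)
    simp only [mul_neg, ← mul_assoc, haG, one_mul] at h1
    rwa [← h1]
  have hconst : ∀ y, HasDerivMat (fun y => F y * (G y).adjugate) 0 y := by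
    intro y
    have h := (hF y).mul (hadj y)
    rwa [mul_neg, ← mul_assoc, add_neg_cancel] at h
  have hxa : F x * (G x).adjugate = F a * (G a).adjugate := by
    ext i k
    exact is_const_of_deriv_eq_zero (fun y => (hconst y i k).differentiableAt)
      (fun y => (hconst y i k).deriv) x a
  rw [ha, hGa] at hxa
  calc F x = F x * ((G x).adjugate * G x) := by rw [haG, mul_one]
    _ = G x := by rw [← mul_assoc, hxa, one_mul]

end Calculus

/-! ### Moving frames -/

section Frames

variable {n : ℕ}

lemma mulVec_e1_apply (A : Mat n) (i : Fin n) {z : Fin n} (hz : z.val = 0) :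
    A.mulVec (e1 n) i = A i z := by
  rw [Matrix.mulVec, dotProduct, Finset.sum_eq_single z]
  · simp [e1, hz]
  · intro s _ hs
    have : ¬ s.val = 0 := fun h => hs (Fin.ext (by omega))
    simp [e1, this]
  · simp

lemma curvature_mem_V (γ : ℝ → Fin n → ℝ) (x : ℝ) : curvature γ x ∈ V n :=
  fun i k h => by simp [curvature, h]

/-- If `G' = G (b + u)` with `u ∈ V_n`, then each column of `G` is the derivative of the preceding
one, so `G` is the moving frame of its first column. -/
lemma frame_eq_of_hasDerivMat {G u : ℝ → Mat n} (hu : ∀ x, u x ∈ V n)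
    (hG : ∀ x, HasDerivMat G (G x * (bMat n + u x)) x) {γ : ℝ → Fin n → ℝ}
    (hγ : ∀ x, γ x = (G x).mulVec (e1 n)) : frame γ = G := by
  have key : ∀ (k : ℕ) (hk : k < n), iteratedDeriv k γ = fun x i => G x i ⟨k, hk⟩ := by
    intro k
    induction k with
    | zero =>
      intro hk
      funext x i
      rw [iteratedDeriv_zero, hγ, mulVec_e1_apply _ _ (z := ⟨0, hk⟩) rfl]
    | succ k ih =>
      intro hk
      rw [iteratedDeriv_succ, ih (by omega)]
      funext x
      refine (hasDerivAt_pi.mpr fun i => ?_).deriv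
      have h := hG x i ⟨k, by omega⟩
      rwa [mul_add, Matrix.add_apply, mul_bMat_apply_succ _ _ (k' := ⟨k + 1, hk⟩) rfl,
        mul_apply_of_mem_V (hu x) _ _ (by simp only; omega), add_zero] at h
  funext x
  ext i k
  rw [frame, Matrix.of_apply, key k.val k.isLt]

/-- If `G' = G (b + u)` with `u ∈ V_n` and `det G = 1`, then `u` is the curvature of the first
column of `G`, by Cramer's rule. -/
lemma curvature_eq_of_hasDerivMat (hn : 1 ≤ n) {G u : ℝ → Mat n} (hu : ∀ x, u x ∈ V n)
    (hG : ∀ x, HasDerivMat G (G x * (bMat n + u x)) x) (hdet : ∀ x, (G x).det = 1)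
    {γ : ℝ → Fin n → ℝ} (hγ : ∀ x, γ x = (G x).mulVec (e1 n)) : curvature γ = u := by
  have hframe := frame_eq_of_hasDerivMat hu hG hγ
  let l : Fin n := ⟨n - 1, by omega⟩
  have hl : l.val + 1 = n := Nat.sub_add_cancel hn
  have hlast : ∀ x, iteratedDeriv n γ x = (G x).mulVec fun i => u x i l := by
    intro x
    have hcol : iteratedDeriv l.val γ = fun x i => G x i l := by
      funext y i
      exact congrFun (congrFun (congrFun hframe y) i) l
    have hsucc : iteratedDeriv n γ = deriv (iteratedDeriv l.val γ) := by
      rw [← iteratedDeriv_succ, hl]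
    rw [hsucc, hcol]
    refine (hasDerivAt_pi.mpr fun i => ?_).deriv
    have h := hG x i l
    rwa [mul_add, Matrix.add_apply, mul_bMat_apply_last _ _ hl, zero_add] at h
  funext x
  ext i k
  by_cases h : k.val + 1 = n ∧ i.val + 1 < n
  · obtain rfl : k = l := Fin.ext (by omega)
    rw [curvature, Matrix.of_apply, if_pos h, hframe, hlast, ← Matrix.cramer_apply,
      Matrix.cramer_eq_adjugate_mulVec, Matrix.mulVec_mulVec, Matrix.adjugate_mul, hdet, one_smul,
      Matrix.one_mulVec]
  · rw [curvature_mem_V γ x i k h, hu x i k h]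

lemma hasDerivAt_iteratedDeriv {γ : ℝ → Fin n → ℝ} (hγ : ContDiff ℝ ∞ γ) (k : ℕ) (x : ℝ)
    (i : Fin n) :
    HasDerivAt (fun y => iteratedDeriv k γ y i) (iteratedDeriv (k + 1) γ x i) x := by
  rw [iteratedDeriv_succ]
  exact hasDerivAt_pi.mp
    (hγ.differentiable_iteratedDeriv k (by exact_mod_cast WithTop.coe_lt_top _) x).hasDerivAt i

/-- The structure equation of the moving frame. The last coordinate of `γ^{(n)}` in the moving
frame is the derivative of `det (γ, …, γ^{(n-1)}) = 1`, hence `0`. -/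
lemma IsCentralAffineCurve.hasDerivMat_frame (hn : 1 ≤ n) {γ : ℝ → Fin n → ℝ}
    (hγ : IsCentralAffineCurve γ) (x : ℝ) :
    HasDerivMat (frame γ) (frame γ x * (bMat n + curvature γ x)) x := by
  let l : Fin n := ⟨n - 1, by omega⟩
  have hl : l.val + 1 = n := Nat.sub_add_cancel hn
  let F' : Mat n := Matrix.of fun i k => iteratedDeriv (k.val + 1) γ x i
  have hF : HasDerivMat (frame γ) F' x := fun i k => hasDerivAt_iteratedDeriv hγ.smooth k.val x i
  have hcramer : (frame γ x).cramer (iteratedDeriv n γ x) l = 0 := by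
    have h := hF.det.unique ((hasDerivAt_const x (1 : ℝ)).congr_of_eventuallyEq
      (Filter.Eventually.of_forall hγ.det_frame))
    rw [Finset.sum_eq_single l] at h
    · rw [Matrix.cramer_apply, ← h]
      congr 2
      funext i
      simp only [F', Matrix.of_apply, hl]
    · intro k _ hk
      have hk' : k.val + 1 < n := by
        have := k.isLt
        by_contra hcon
        exact hk (Fin.ext (by omega))
      -- The derivative of the `k`-th column is the next column.
      refine Matrix.det_zero_of_column_eq (i := k) (j := ⟨k.val + 1, hk'⟩)
        (fun e => by simpa using congrArg Fin.val e) fun i => ?_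
      rw [Matrix.updateCol_self, Matrix.updateCol_ne (fun e => by simpa using congrArg Fin.val e)]
      rfl
    · simp
  have hcol : ∀ s, curvature γ x s l = (frame γ x).cramer (iteratedDeriv n γ x) s := by
    intro s
    by_cases hs : s.val + 1 < n
    · simp [curvature, hl, hs, Matrix.cramer_apply]
    · obtain rfl : s = l := Fin.ext (by have := s.isLt; omega)
      rw [hcramer, curvature_mem_V γ x _ _ (by omega)]
  have hF' : F' = frame γ x * (bMat n + curvature γ x) := by
    ext i k
    rw [mul_add, Matrix.add_apply]
    by_cases hk : k.val + 1 = n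
    · obtain rfl : k = l := Fin.ext (by omega)
      have h := congrFun (Matrix.mulVec_cramer (frame γ x) (iteratedDeriv n γ x)) i
      rw [hγ.det_frame, one_smul] at h
      rw [mul_bMat_apply_last _ _ hk, zero_add, Matrix.mul_apply]
      simp only [hcol, F', Matrix.of_apply, hl]
      exact h.symm
    · rw [mul_apply_of_mem_V (curvature_mem_V γ x) _ _ hk, add_zero,
        mul_bMat_apply_succ _ _ (k' := ⟨k.val + 1, by have := k.isLt; omega⟩) rfl]
      rfl
  rwa [← hF']

lemma iteratedDeriv_periodic {γ : ℝ → Fin n → ℝ} {T : ℝ} (hγ : Function.Periodic γ T) (k : ℕ) :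
    Function.Periodic (iteratedDeriv k γ) T := by
  intro x
  have h := iteratedDeriv_comp_add_const k γ T
  rw [show (fun y => γ (y + T)) = γ from funext hγ] at h
  exact (congrFun h x).symm

lemma frame_periodic {γ : ℝ → Fin n → ℝ} {T : ℝ} (hγ : Function.Periodic γ T) :
    Function.Periodic (frame γ) T := by
  intro x
  ext i k
  simp only [frame, Matrix.of_apply, iteratedDeriv_periodic hγ k.val x]

end Frames

/-! ### The Cauchy problem -/

section Cauchy

variable {n : ℕ}

lemma SmoothMat₂.smoothMat_left {A : ℝ → ℝ → Mat n} (hA : SmoothMat₂ A) (t : ℝ) :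
    SmoothMat (fun x => A x t) :=
  fun i k => (hA i k).comp (contDiff_id.prodMk contDiff_const)

lemma SmoothMat₂.smoothMat_right {A : ℝ → ℝ → Mat n} (hA : SmoothMat₂ A) (x : ℝ) :
    SmoothMat (fun t => A x t) :=
  fun i k => (hA i k).comp (contDiff_const.prodMk contDiff_id)

lemma eq_mul_of_inv_mul_eq {A : Matrix.SpecialLinearGroup (Fin n) ℝ} {B C : Mat n}
    (h : (A : Mat n)⁻¹ * B = C) : B = A * C := by
  rw [← h, Matrix.mul_nonsing_inv_cancel_left]
  simp

variable {j : ℕ} {u : ℝ → ℝ → Mat n} {g : ℝ → ℝ → Matrix.SpecialLinearGroup (Fin n) ℝ}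

lemma IsFrameSolution.hasDerivMat_x (hg : IsFrameSolution j u g) (t x : ℝ) :
    HasDerivMat (fun y => (g y t : Mat n)) (g x t * (bMat n + u x t)) x := by
  rw [← eq_mul_of_inv_mul_eq (hg.eqn_x x t)]
  exact (hg.smooth.smoothMat_left t).hasDerivMat x

lemma IsFrameSolution.hasDerivMat_t (hg : IsFrameSolution j u g) (x t : ℝ) :
    HasDerivMat (fun s => (g x s : Mat n)) (g x t * Zj0 j (fun y => u y t) x) t := by
  rw [← eq_mul_of_inv_mul_eq (hg.eqn_t x t)]
  exact (hg.smooth.smoothMat_right x).hasDerivMat t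

/-- At `t = 0` the solution `g` is the moving frame of the initial curve. -/
lemma IsFrameSolution.eq_frame (hn : 1 ≤ n) (hg : IsFrameSolution j u g) {γ₀ : ℝ → Fin n → ℝ}
    (hγ₀ : IsCentralAffineCurve γ₀) (hu₀ : ∀ x, u x 0 = curvature γ₀ x)
    (hg₀ : (g 0 0 : Mat n) = frame γ₀ 0) (x : ℝ) : (g x 0 : Mat n) = frame γ₀ x := by
  refine (eq_of_hasDerivMat_mul (F := frame γ₀) (G := fun y => (g y 0 : Mat n))
    (A := fun y => bMat n + u y 0) (fun y => ?_) (hg.hasDerivMat_x 0)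
    (hg.smooth.smoothMat_left 0) (fun y => (g y 0).2) hg₀.symm x).symm
  simp only [hu₀]
  exact hγ₀.hasDerivMat_frame hn y

/-- Periodicity of `g` in `x` propagates in `t`: `g (x + T, ·)` and `g (x, ·)` solve the same
linear equation `g_t = g Z`, because `Z` is `T`-periodic in `x`. -/
lemma IsFrameSolution.periodic {T : ℝ} (hg : IsFrameSolution j u g)
    (hZ : ∀ t, Function.Periodic (Zj0 j fun y => u y t) T)
    (h0 : ∀ x, (g (x + T) 0 : Mat n) = g x 0) (x t : ℝ) :
    (g (x + T) t : Mat n) = g x t := by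
  refine eq_of_hasDerivMat_mul (F := fun s => (g (x + T) s : Mat n))
    (G := fun s => (g x s : Mat n)) (A := fun s => Zj0 j (fun y => u y s) x) (fun s => ?_)
    (hg.hasDerivMat_t x) (hg.smooth.smoothMat_right x) (fun s => (g x s).2) (h0 x) t
  have h := hg.hasDerivMat_t (x + T) s
  rwa [hZ s x] at h

end Cauchy

end CentralAffine

theorem mainTheorem2 (n : ℕ) (hn : 2 ≤ n) (j : ℕ) (hj : 1 ≤ j) (hjn : ¬ n ∣ j)
    (γ₀ : ℝ → Fin n → ℝ) (hγ₀ : CentralAffine.IsPeriodicCentralAffineCurve γ₀)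
    (u : ℝ → ℝ → Matrix (Fin n) (Fin n) ℝ)
    (hu : CentralAffine.IsPeriodicKdVSolution j u)
    (hu₀ : ∀ x, u x 0 = CentralAffine.curvature γ₀ x)
    (g : ℝ → ℝ → Matrix.SpecialLinearGroup (Fin n) ℝ)
    (hg : CentralAffine.IsFrameSolution j u g)
    (hg₀ : (g 0 0 : Matrix (Fin n) (Fin n) ℝ) = CentralAffine.frame γ₀ 0)
    (γ : ℝ → ℝ → Fin n → ℝ)
    (hγ : ∀ x t, γ x t = (g x t : Matrix (Fin n) (Fin n) ℝ).mulVec (CentralAffine.e1 n)) :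
    CentralAffine.IsCurveFlowSolution j γ ∧
    (∀ x, γ x 0 = γ₀ x) ∧
    (∀ t, Function.Periodic (fun x => γ x t) (2 * Real.pi)) ∧
    (∀ x t, CentralAffine.curvature (fun y => γ y t) x = u x t) := by
  open CentralAffine in
  have hn1 : 1 ≤ n := by omega
  let z : Fin n := ⟨0, hn1⟩
  have hγz : ∀ x t i, γ x t i = (g x t : Mat n) i z := fun x t i => by
    rw [hγ, mulVec_e1_apply _ _ (z := z) rfl]
  have hdet : ∀ x t, (g x t : Mat n).det = 1 := fun x t => (g x t).2
  have huV : ∀ t x, u x t ∈ V n := fun t x => hu.mem_V x t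
  have hframe : ∀ t, frame (fun y => γ y t) = fun y => (g y t : Mat n) := fun t =>
    frame_eq_of_hasDerivMat (huV t) (hg.hasDerivMat_x t) fun x => hγ x t
  have hcurv : ∀ t, curvature (fun y => γ y t) = fun y => u y t := fun t =>
    curvature_eq_of_hasDerivMat hn1 (huV t) (hg.hasDerivMat_x t) (fun x => hdet x t)
      fun x => hγ x t
  have hinit : ∀ x, (g x 0 : Mat n) = frame γ₀ x :=
    hg.eq_frame hn1 hγ₀.toIsCentralAffineCurve hu₀ hg₀
  refine ⟨⟨?_, fun t => ⟨?_, fun x hx => ?_, fun x => ?_⟩, fun x t => ?_⟩, fun x => ?_,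
    fun t x => ?_, fun x t => congrFun (hcurv t) x⟩
  · refine contDiff_pi.mpr fun i => ?_
    simp only [hγz]
    exact hg.smooth i z
  · refine contDiff_pi.mpr fun i => ?_
    simp only [hγz]
    exact hg.smooth.smoothMat_left t i z
  · have h0 : (g x t : Mat n).det = 0 :=
      Matrix.det_eq_zero_of_column_eq_zero z fun i => by rw [← hγz]; exact congrFun hx i
    rw [hdet] at h0
    exact one_ne_zero h0
  · rw [hframe]
    exact hdet x t
  · rw [hframe, hcurv]
    refine (hasDerivAt_pi.mpr fun i => ?_).deriv
    rw [mulVec_e1_apply _ _ (z := z) rfl]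
    simp only [hγz]
    exact hg.hasDerivMat_t x t i z
  · funext i
    rw [hγz, hinit, frame, Matrix.of_apply]
    exact congrFun (congrFun iteratedDeriv_zero x) i
  · have hZ : ∀ t, Function.Periodic (Zj0 j fun y => u y t) (2 * Real.pi) := fun t =>
      Zj0_periodic hn1 j (huV t) (hu.periodic t)
    have h0 : ∀ x, (g (x + 2 * Real.pi) 0 : Mat n) = g x 0 := fun x => by
      rw [hinit, hinit, frame_periodic hγ₀.periodic x]
    simp only [hγ, hg.periodic hZ h0 x t]
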